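/- Let $K>1$ and $M>1$ be integers. A problem instance is a matrix $\boldsymbol\mu=[\mu_{k,m}]\in\mathbb R^{K\times M}$: there are $M$ clients, each with $K$ arms, and the reward $X_{k,m}(n)$ of arm $k$ of client $m$ at time $n$ is Gaussian with mean $\mu_{k,m}$ and variance $1$, all rewards being independent. Put $\mu_k=\frac1M\sum_{m=1}^M\mu_{k,m}$. The local best arm of client $m$ is $k_m^*=\arg\max_k\mu_{k,m}$, the global best arm is $k^*=\arg\max_k\mu_k$, and the instance is assumed to be such that all these maximisers are unique; write $\mathbf S(\boldsymbol\mu)=(k_1^*,\dots,k_M^*,k^*)$. Let $\Delta_{k,m}=\mu_{k_m^*,m}-\mu_{k,m}$ for $k\ne k_m^*$, $\Delta_{k_m^*,m}=\min_{k\neq k_m^*}\Delta_{k,m}$, $\Delta_k=\mu_{k^*}-\mu_k$ for $k\neq k^*$, and $\Delta_{k^*}=\min_{k\ne k^*}\Delta_k$. A (possibly randomised) algorithm $\pi$ proceeds in time steps. In each time step every client selects a set of its own arms, on the basis of its own past observations, the messages it received from a central server, and internal randomness that is independent of the rewards, and it observes the rewards of the selected arms at that time; then every client may send a message to the server, based on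 what it knows, and the server, on the basis of the messages that it received and the internal randomness, sends a message back to every client. A termination rule specifies when to stop, and a declaration rule specifies the estimate $\hat{\mathbf S}\in[K]^{M+1}$ of $\mathbf S(\boldsymbol\mu)$ that is declared upon termination. For $\delta\in(0,1)$, $\pi$ is $\delta$-PAC if $P^\pi_{\boldsymbol\mu}(\pi\text{ terminates and }\hat{\mathbf S}=\mathbf S(\boldsymbol\mu))\ge 1-\delta$ for every instance $\boldsymbol\mu$ whose local and global best arms are unique. Let $T^\pi_\delta\in[0,\infty]$ be the total number of arm selections made by all clients under $\pi$ until termination. Then for every $\delta\in(0,1)$ and every instance $\boldsymbol\mu$ with unique local and global best arms, $$\inf_{\pi}\ \mathbb E^\pi_{\boldsymbol\mu}\big[T^\pi_\delta\big]\ \ge\ \sum_{k=1}^K\sum_{m=1}^M\max\left\{\frac{\ln\left(\frac1{2.4\,\delta}\right)}{\Delta_{k,m}^2},\ \frac{\ln\left(\frac1{2.4\,\delta}\right)}{M^2\Delta_k^2}\right\},$$ where the infimum is over all $\delta$-PAC algorithms $\pi$ under which, until termination, every client communicates with the server in every time step. -/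

import Mathlib

open MeasureTheory ProbabilityTheory

noncomputable section

namespace FedBandit

/-! ### Problem instances, best arms and gaps -/

/-- A problem instance: `μ k m` is the mean of arm `k` of client `m`. -/
abbrev Instance (K M : ℕ) := Fin K → Fin M → ℝ

/-- The mean of arm `k` averaged over the clients. -/
def globalMean {K M : ℕ} (μ : Instance K M) (k : Fin K) : ℝ := (∑ m, μ k m) / M

/-- An answer: one arm for each client, and one global arm. -/
abbrev Answer (K M : ℕ) := (Fin M → Fin K) × Fin K

/-- `s` is the vector of the local best arms and the global best arm of `μ`, all of which
exist and are unique. -/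
def IsAnswer {K M : ℕ} (μ : Instance K M) (s : Answer K M) : Prop :=
  (∀ m, ∀ j, j ≠ s.1 m → μ j m < μ (s.1 m) m) ∧
    ∀ j, j ≠ s.2 → globalMean μ j < globalMean μ s.2

/-- The gaps of a family of means `v` with unique best arm `b`: `v b - v k` for `k ≠ b`, and the
smallest of these for `k = b`. -/
def gap {K : ℕ} (v : Fin K → ℝ) (b k : Fin K) : ℝ :=
  if k = b then ⨅ j : {j : Fin K // j ≠ b}, (v b - v j) else v b - v k

/-- The local gap of arm `k` of client `m`. -/
def localGap {K M : ℕ} (μ : Instance K M) (s : Answer K M) (k : Fin K) (m : Fin M) : ℝ :=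
  gap (fun j => μ j m) (s.1 m) k

/-- The global gap of arm `k`. -/
def globalGap {K M : ℕ} (μ : Instance K M) (s : Answer K M) (k : Fin K) : ℝ :=
  gap (globalMean μ) s.2 k

/-! ### Algorithms -/

/-- What a client observes in one time step: `Sum.inl r` for an arm that it selected and that
generated reward `r`, and `Sum.inr ()` for an arm that it did not select. -/
abbrev Obs (K : ℕ) := Fin K → ℝ ⊕ Unit

/-- Use of the uplink of a client in one time step: `Sum.inl a` if the client communicates
message `a`, and `Sum.inr ()` if it does not communicate. -/
abbrev Uplink (Up : Type) := Up ⊕ Unit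

/-- All that happens in one time step: the observations of the clients, the use of the uplinks,
and the downlink messages. -/
abbrev Step (K M : ℕ) (Up Down : Type) :=
  (Fin M → Obs K) × (Fin M → Uplink Up) × (Fin M → Down)

/-- A (possibly randomised) federated algorithm with `K` arms and `M` clients. Time steps are
numbered `0, 1, 2, …`. In time step `n`, in this order: each client selects a set of its arms and
observes their rewards; each client decides whether to communicate with the server and what to
send; the server answers each client. A client knows the seed, its own observations and the
downlink messages it received; the server knows the seed and the uplink messages. -/
structure Algorithm (K M : ℕ) where
  /-- Internal randomness, independent of the rewards. -/
  Seed : Type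
  [seedSpace : MeasurableSpace Seed]
  seedLaw : Measure Seed
  [seedProb : IsProbabilityMeasure seedLaw]
  /-- Uplink messages. -/
  Up : Type
  [upSpace : MeasurableSpace Up]
  /-- Downlink messages. -/
  Down : Type
  [downSpace : MeasurableSpace Down]
  /-- Selection rule of client `m` in time step `n`, given the seed, the client's observations
  and the downlink messages to the client in the time steps before `n`. -/
  select (n : ℕ) (m : Fin M) : Seed × (Fin n → Obs K) × (Fin n → Down) → Finset (Fin K)
  select_measurable : ∀ n m, Measurable (select n m)
  /-- Communication rule of client `m` in time step `n`, given the seed, the client's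
  observations up to and including step `n`, and the downlink messages before `n`. -/
  send (n : ℕ) (m : Fin M) : Seed × (Fin (n + 1) → Obs K) × (Fin n → Down) → Uplink Up
  send_measurable : ∀ n m, Measurable (send n m)
  /-- Downlink message of the server to client `m` in time step `n`, given the seed and the use
  of all uplinks up to and including step `n`. -/
  reply (n : ℕ) (m : Fin M) : Seed × (Fin (n + 1) → Fin M → Uplink Up) → Down
  reply_measurable : ∀ n m, Measurable (reply n m)
  /-- Termination rule: whether to terminate after `n` time steps, given all that happened. -/
  halt (n : ℕ) : Seed × (Fin n → Step K M Up Down) → Bool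
  halt_measurable : ∀ n, Measurable (halt n)
  /-- Declaration rule: the answer declared on termination after `n` time steps. -/
  output (n : ℕ) : Seed × (Fin n → Step K M Up Down) → Answer K M
  output_measurable : ∀ n, Measurable (output n)

attribute [instance] Algorithm.seedSpace Algorithm.seedProb Algorithm.upSpace Algorithm.downSpace

namespace Algorithm

variable {K M : ℕ} (π : Algorithm K M)

/-- Sample space: the seed, and the reward `X (n, k, m)` of arm `k` of client `m` at time `n`. -/
abbrev Sample : Type := π.Seed × (ℕ × Fin K × Fin M → ℝ)

/-- The law of the seed and the rewards under the instance `μ`: all are independent, and the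
reward of arm `k` of client `m` is Gaussian with mean `μ k m` and variance `1` at all times. -/
def law (μ : Instance K M) : Measure π.Sample :=
  π.seedLaw.prod (Measure.infinitePi fun i : ℕ × Fin K × Fin M => gaussianReal (μ i.2.1 i.2.2) 1)

/-- The set of arms that client `m` selects in time step `n`, after the history `h`. -/
def chosen (u : π.Seed) (n : ℕ) (h : Fin n → Step K M π.Up π.Down) (m : Fin M) :
    Finset (Fin K) :=
  π.select n m (u, fun i => (h i).1 m, fun i => (h i).2.2 m)

/-- Time step `n` after the history `h`. -/
def next (ω : π.Sample) (n : ℕ) (h : Fin n → Step K M π.Up π.Down) : Step K M π.Up π.Down :=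
  let obs : Fin M → Obs K := fun m k =>
    if k ∈ π.chosen ω.1 n h m then Sum.inl (ω.2 (n, k, m)) else Sum.inr ()
  let up : Fin M → Uplink π.Up := fun m =>
    π.send n m (ω.1, Fin.snoc (α := fun _ => Obs K) (fun i => (h i).1 m) (obs m),
      fun i => (h i).2.2 m)
  let down : Fin M → π.Down := fun m =>
    π.reply n m (ω.1, Fin.snoc (α := fun _ => Fin M → Uplink π.Up) (fun i => (h i).2.1) up)
  (obs, up, down)

/-- The history of the first `n` time steps. -/
def hist (ω : π.Sample) : (n : ℕ) → Fin n → Step K M π.Up π.Down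
  | 0 => Fin.elim0
  | n + 1 => Fin.snoc (α := fun _ => Step K M π.Up π.Down) (hist ω n) (π.next ω n (hist ω n))

/-- The termination rule applies after `n` time steps. -/
def StopsAt (ω : π.Sample) (n : ℕ) : Prop := π.halt n (ω.1, π.hist ω n) = true

/-- The algorithm has not terminated before time step `n`, so that this step is carried out. -/
def Running (ω : π.Sample) (n : ℕ) : Prop := ∀ j ≤ n, ¬ π.StopsAt ω j

/-- The algorithm terminates, and declares the answer `s`. -/
def Declares (ω : π.Sample) (s : Answer K M) : Prop :=
  ∃ n, π.StopsAt ω n ∧ (∀ j < n, ¬ π.StopsAt ω j) ∧ π.output n (ω.1, π.hist ω n) = s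

/-- `π` is `δ`-PAC: under every instance for which the local best arms and the global best arm
are well defined (unique), it declares them with probability at least `1 - δ`. -/
def IsPAC (δ : ℝ) : Prop :=
  ∀ (μ : Instance K M) (s : Answer K M), IsAnswer μ s →
    ENNReal.ofReal (1 - δ) ≤ π.law μ {ω | π.Declares ω s}

/-- Until termination, every client communicates with the server in every time step (almost
surely, under every instance). -/
def CommunicatesEveryStep : Prop :=
  ∀ μ : Instance K M, ∀ᵐ ω ∂(π.law μ), ∀ n, π.Running ω n →
    ∀ m, ((π.next ω n (π.hist ω n)).2.1 m).isLeft = true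

open Classical in
/-- The number of selections of arm `k` of client `m` until termination (`∞` if there are
infinitely many). -/
def pulls (ω : π.Sample) (k : Fin K) (m : Fin M) : ENNReal :=
  ∑' n : ℕ, if π.Running ω n ∧ k ∈ π.chosen ω.1 n (π.hist ω n) m then 1 else 0

/-- The total number of arm selections until termination. -/
def totalPulls (ω : π.Sample) : ENNReal := ∑ k, ∑ m, π.pulls ω k m

/-- The expected total number of arm selections under the instance `μ`. -/
def expectedPulls (μ : Instance K M) : ENNReal := ∫⁻ ω, π.totalPulls ω ∂(π.law μ)

end Algorithm

end FedBandit

end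

/-!
The proof is a change of measure. Fix a `δ`-PAC algorithm and the true instance `μ` with answer `s`.
If another instance `ν` has a different answer, then the event "the algorithm declares `s`" has
probability at least `1 - δ` under `μ` and at most `δ` under `ν`, so the observations up to
termination have to carry a relative entropy of at least
`(1 - 2 * δ) * log ((1 - δ) / δ)`, which is at least half of `log (1 / (2.4 * δ))`
(`log_le_two_mul_one_sub_two_mul_log`). On the other hand, by Wald's identity this relative entropy
is at most `∑ (μ k m - ν k m) ^ 2 / 2 * N k m`, where `N k m` is the expected number of selections
of arm `k` of client `m` under `μ`.

The log-likelihood ratio involves only the rewards that were observed before termination. For a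
fixed seed, the sets of observed arms form an adaptive sampling rule on the reward paths
(`Algorithm.adaptive_sampled`): each is determined by earlier observed rewards. For such rules,
`lintegral_pathLaw_change` gives the density of the observations under `ν` with respect to that
under `μ`, by induction on the time, resampling the rewards of one time step at each stage;
`integral_logRatio` is Wald's identity. Both are used with a finite horizon `n`, and combined by
Jensen's inequality (`mul_prob_sub_le_log`); then `n` tends to infinity
(`Algorithm.IsPAC.mul_sub_sum_le_log`).

It remains to choose `ν`. Only the mean of arm `k` of client `m` is shifted: by slightly more than
the local gap to change the best arm of the client, or by slightly more than `M` times the global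
gap to change the global best arm; upwards if arm `k` was not the best one, and downwards if it was.
Such a `ν` may have ties between other arms. All its small tilts `ν k m + t * k` with `t ≠ 0` have
unique best arms, and if all `N k m` are finite then the bound passes to the limit `t → 0`
(`Algorithm.IsPAC.log_le_sum_of_beaten`). If some `N k m` is infinite, there is nothing to prove.
-/

noncomputable section

namespace FedBandit

/-! ### Change of mean for independent Gaussians -/

/-- The density at `y` of `gaussianReal b 1` with respect to `gaussianReal a 1`. -/
def likelihood (a b y : ℝ) : ENNReal :=
  ENNReal.ofReal (Real.exp (-((a - b) * (y - a) + (a - b) ^ 2 / 2)))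

lemma measurable_likelihood (a b : ℝ) : Measurable (likelihood a b) := by
  unfold likelihood; fun_prop

lemma gaussianReal_withDensity_likelihood (a b : ℝ) :
    (gaussianReal a 1).withDensity (likelihood a b) = gaussianReal b 1 := by
  rw [gaussianReal_of_var_ne_zero a one_ne_zero, gaussianReal_of_var_ne_zero b one_ne_zero,
    ← withDensity_mul _ (measurable_gaussianPDF a 1) (measurable_likelihood a b)]
  congr 1
  ext y
  simp only [Pi.mul_apply, gaussianPDF, likelihood, gaussianPDFReal]
  rw [← ENNReal.ofReal_mul (by positivity), mul_assoc, ← Real.exp_add]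
  congr 3
  simp only [NNReal.coe_one]
  ring

section Pi
variable {ι : Type*} [Fintype ι]

lemma pi_withDensity {X : ι → Type*} [∀ i, MeasurableSpace (X i)] (μ ν : ∀ i, Measure (X i))
    [∀ i, IsProbabilityMeasure (μ i)] [∀ i, IsProbabilityMeasure (ν i)]
    {f : ∀ i, X i → ENNReal} (hf : ∀ i, Measurable (f i))
    (h : ∀ i, (μ i).withDensity (f i) = ν i) :
    (Measure.pi μ).withDensity (fun x => ∏ i, f i (x i)) = Measure.pi ν := by
  refine (Measure.pi_eq fun s hs => ?_).symm
  rw [withDensity_apply _ (MeasurableSet.univ_pi hs), ← lintegral_indicator (MeasurableSet.univ_pi hs)]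
  have key : ∀ x : ∀ i, X i, (Set.univ.pi s).indicator (fun x => ∏ i, f i (x i)) x
      = ∏ i, (s i).indicator (f i) (x i) := by
    intro x
    by_cases hx : x ∈ Set.univ.pi s
    · rw [Set.indicator_of_mem hx]
      exact Finset.prod_congr rfl fun i _ => (Set.indicator_of_mem (hx i trivial) _).symm
    · rw [Set.indicator_of_notMem hx]
      simp only [Set.mem_pi, Set.mem_univ, true_imp_iff, not_forall] at hx
      obtain ⟨i, hi⟩ := hx
      exact (Finset.prod_eq_zero (Finset.mem_univ i) (Set.indicator_of_notMem hi _)).symm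
  have hmeas : ∀ i, Measurable ((s i).indicator (f i)) := fun i => (hf i).indicator (hs i)
  simp_rw [key]
  rw [lintegral_prod_eq_prod_lintegral_of_indepFun Finset.univ
    (fun i (x : ∀ i, X i) => (s i).indicator (f i) (x i))
    (iIndepFun_pi (X := fun i => (s i).indicator (f i)) fun i => (hmeas i).aemeasurable)
    fun i => (hmeas i).comp (measurable_pi_apply i)]
  refine Finset.prod_congr rfl fun i _ => ?_
  rw [← h i, withDensity_apply _ (hs i), ← lintegral_indicator (hs i)]
  exact (measurePreserving_eval μ i).lintegral_comp (hmeas i)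

/-- The law of the rewards of one time step: independent Gaussians with means `a`. -/
abbrev stepLaw (a : ι → ℝ) : Measure (ι → ℝ) := Measure.pi fun i => gaussianReal (a i) 1

lemma stepLaw_map_add (a c : ι → ℝ) : (stepLaw a).map (fun x i => x i + c i) = stepLaw (a + c) := by
  have : ∀ i, SigmaFinite ((gaussianReal (a i) 1).map (fun x => x + c i)) := fun i => by
    rw [gaussianReal_map_add_const]; infer_instance
  rw [stepLaw, Measure.pi_map_pi (f := fun i x => x + c i) fun i => by fun_prop]
  simp_rw [gaussianReal_map_add_const]
  rfl

/-- A function of the coordinates in `S` alone needs the likelihood ratios of these coordinates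
only: the means of the others may be changed for free, by translation. -/
lemma lintegral_stepLaw_change (a b : ι → ℝ) (S : Finset ι) {F : (ι → ℝ) → ENNReal}
    (hF : Measurable F) (hdep : DependsOn F (S : Set ι)) :
    ∫⁻ y, F y ∂(stepLaw b)
      = ∫⁻ y, F y * ∏ i ∈ S, likelihood (a i) (b i) (y i) ∂(stepLaw a) := by
  classical
  let c : ι → ℝ := fun i => if i ∈ S then b i else a i
  have h1 : ∫⁻ y, F y ∂(stepLaw b) = ∫⁻ y, F y ∂(stepLaw c) := by
    have : stepLaw c = (stepLaw b).map (fun x i => x i + (c i - b i)) := by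
      rw [stepLaw_map_add b (fun i => c i - b i)]
      congr 1; ext i; simp
    rw [this, lintegral_map hF (by fun_prop)]
    refine lintegral_congr fun y => hdep fun i hi => ?_
    simp [c, Finset.mem_coe.1 hi]
  have h2 : (stepLaw a).withDensity
      (fun y => ∏ i, (if i ∈ S then likelihood (a i) (b i) (y i) else 1)) = stepLaw c := by
    refine pi_withDensity (f := fun i y => if i ∈ S then likelihood (a i) (b i) y else 1)
      _ _ (fun i => ?_) fun i => ?_
    · by_cases hi : i ∈ S
      · simpa [hi] using measurable_likelihood _ _
      · simp [hi]
    · by_cases hi : i ∈ S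
      · simpa [hi, c] using gaussianReal_withDensity_likelihood _ _
      · simp only [hi, if_false, c]
        exact withDensity_one
  rw [h1, ← h2, lintegral_withDensity_eq_lintegral_mul _ _ hF]
  · refine lintegral_congr fun y => ?_
    rw [Pi.mul_apply, mul_comm, Finset.prod_ite_mem, Finset.univ_inter]
  · refine Finset.measurable_prod _ fun i _ => ?_
    by_cases hi : i ∈ S
    · simp only [hi, if_true]
      exact (measurable_likelihood _ _).comp (measurable_pi_apply i)
    · simp [hi]

end Pi

/-! ### Resampling one time step -/

section Resample
variable {ι : Type*}

/-- The rewards `x`, with those at time `n` replaced by `y`. -/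
def resample (n : ℕ) (x : ℕ × ι → ℝ) (y : ι → ℝ) : ℕ × ι → ℝ :=
  fun p => if p.1 = n then y p.2 else x p

lemma measurable_resample (n : ℕ) :
    Measurable fun p : (ℕ × ι → ℝ) × (ι → ℝ) => resample n p.1 p.2 := by
  refine measurable_pi_lambda _ fun q => ?_
  by_cases h : q.1 = n
  · simp only [resample, h, if_true]; fun_prop
  · simp only [resample, h, if_false]; fun_prop

variable [Fintype ι]

/-- The law of all rewards, when the reward of arm `i` has mean `a i` at all times. -/
abbrev pathLaw (a : ι → ℝ) : Measure (ℕ × ι → ℝ) :=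
  Measure.infinitePi fun p => gaussianReal (a p.2) 1

/-- Replacing the rewards of one time step by independent copies leaves the law of all rewards
unchanged. This stands in for conditioning on the past. -/
lemma map_resample (n : ℕ) (a : ι → ℝ) :
    ((pathLaw a).prod (stepLaw a)).map (fun p => resample n p.1 p.2) = pathLaw a := by
  classical
  refine Measure.eq_infinitePi _ fun s t ht => ?_
  have hpre : (fun p : (ℕ × ι → ℝ) × (ι → ℝ) => resample n p.1 p.2) ⁻¹' ((s : Set (ℕ × ι)).pi t)
      = (((s.filter fun p => p.1 ≠ n : Finset (ℕ × ι)) : Set (ℕ × ι)).pi t) ×ˢ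
        (Set.univ.pi fun i => if (n, i) ∈ s then t (n, i) else Set.univ) := by
    ext ⟨x, y⟩
    simp only [Set.mem_preimage, Set.mem_pi, Set.mem_prod, Finset.mem_coe, Finset.mem_filter,
      resample, Set.mem_univ, true_imp_iff]
    constructor
    · intro h
      refine ⟨fun p hp => by simpa [hp.2] using h p hp.1, fun i => ?_⟩
      split_ifs with hi
      · simpa using h (n, i) hi
      · trivial
    · rintro ⟨h1, h2⟩ ⟨j, i⟩ hp
      by_cases hj : j = n
      · subst hj; simpa [hp] using h2 i
      · simpa [hj] using h1 (j, i) ⟨hp, hj⟩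
  rw [Measure.map_apply (measurable_resample n) (MeasurableSet.pi s.countable_toSet fun i _ => ht i),
    hpre, Measure.prod_prod, Measure.infinitePi_pi _ fun i _ => ht i, Measure.pi_pi,
    ← Finset.prod_filter_mul_prod_filter_not s (fun p => p.1 ≠ n)]
  congr 1
  have himg : s.filter (fun p => ¬ p.1 ≠ n)
      = (Finset.univ.filter fun i => (n, i) ∈ s).image (fun i => (n, i)) := by
    ext ⟨j, i⟩
    simp only [ne_eq, not_not, Finset.mem_filter, Finset.mem_image, Finset.mem_univ, true_and,
      Prod.mk.injEq]
    constructor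
    · rintro ⟨h, rfl⟩; exact ⟨i, h, rfl, rfl⟩
    · rintro ⟨i, h, rfl, rfl⟩; exact ⟨h, rfl⟩
  rw [himg, Finset.prod_image (by intro i _ j _ h; simpa using h), Finset.prod_filter]
  refine Finset.prod_congr rfl fun i _ => ?_
  split_ifs <;> simp

lemma lintegral_resample (n : ℕ) (a : ι → ℝ) {F : (ℕ × ι → ℝ) → ENNReal} (hF : Measurable F) :
    ∫⁻ x, F x ∂(pathLaw a) = ∫⁻ x, ∫⁻ y, F (resample n x y) ∂(stepLaw a) ∂(pathLaw a) := by
  conv_lhs => rw [← map_resample n a]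
  rw [lintegral_map hF (measurable_resample n), lintegral_prod]
  exact (hF.comp (measurable_resample n)).aemeasurable

end Resample

/-! ### Adaptive sampling of reward paths -/

section Adaptive
variable {ι : Type*}

/-- The reward paths `x` and `x'` agree wherever `x` is observed before time `n`, if the set of
arms observed at time `i` is `S i x`. -/
def SameObs (S : ℕ → (ℕ × ι → ℝ) → Finset ι) (n : ℕ) (x x' : ℕ × ι → ℝ) : Prop :=
  ∀ i < n, ∀ k ∈ S i x, x (i, k) = x' (i, k)

/-- The sampling rule `S` uses past observations only. -/
def Adaptive (S : ℕ → (ℕ × ι → ℝ) → Finset ι) : Prop :=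
  ∀ n x x', SameObs S n x x' → S n x = S n x'

variable {S : ℕ → (ℕ × ι → ℝ) → Finset ι}

lemma Adaptive.resample_eq (hS : Adaptive S) {i n : ℕ} (hin : i ≤ n) (x : ℕ × ι → ℝ) (y : ι → ℝ) :
    S i (resample n x y) = S i x :=
  hS i _ _ fun j hj k _ => by simp [resample, (hj.trans_le hin).ne]

/-- The log-likelihood ratio of the means `a` against the means `b`, given what the sampling
rule `S` observes before time `n`. -/
def logRatio (a b : ι → ℝ) (S : ℕ → (ℕ × ι → ℝ) → Finset ι) (n : ℕ) (x : ℕ × ι → ℝ) : ℝ :=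
  ∑ i ∈ Finset.range n, ∑ k ∈ S i x,
    ((a k - b k) * (x (i, k) - a k) + (a k - b k) ^ 2 / 2)

lemma ofReal_exp_neg_logRatio (a b : ι → ℝ) (n : ℕ) (x : ℕ × ι → ℝ) :
    ENNReal.ofReal (Real.exp (-logRatio a b S n x))
      = ∏ i ∈ Finset.range n, ∏ k ∈ S i x, likelihood (a k) (b k) (x (i, k)) := by
  simp only [logRatio, likelihood, ← Finset.sum_neg_distrib, Real.exp_sum]
  rw [ENNReal.ofReal_prod_of_nonneg fun i _ => Finset.prod_nonneg fun k _ => (Real.exp_pos _).le]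
  exact Finset.prod_congr rfl fun i _ =>
    ENNReal.ofReal_prod_of_nonneg fun k _ => (Real.exp_pos _).le

lemma integrable_sub_mean (a : ι → ℝ) (p : ℕ × ι) :
    Integrable (fun x : ℕ × ι → ℝ => x p - a p.2) (pathLaw a) := by
  have h : MeasurePreserving (fun x : ℕ × ι → ℝ => x p) (pathLaw a) (gaussianReal (a p.2) 1) :=
    measurePreserving_eval_infinitePi (fun p : ℕ × ι => gaussianReal (a p.2) 1) p
  have h1 : Integrable (fun y : ℝ => y - a p.2) (gaussianReal (a p.2) 1) :=
    ((memLp_id_gaussianReal 1).integrable le_rfl).sub (integrable_const _)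
  exact h.integrable_comp_of_integrable h1

variable [Fintype ι]

lemma logRatio_eq_sum_ite [DecidableEq ι] (a b : ι → ℝ) (n : ℕ) (x : ℕ × ι → ℝ) :
    logRatio a b S n x = ∑ i ∈ Finset.range n, ∑ k,
      (if k ∈ S i x then (a k - b k) * (x (i, k) - a k) + (a k - b k) ^ 2 / 2 else 0) := by
  simp [logRatio, Finset.sum_ite_mem]

/-- Change of measure for adaptive sampling: the law of the observations before time `n` under
the means `b` has density `exp (-logRatio)` with respect to that under the means `a`. -/
theorem lintegral_pathLaw_change (a b : ι → ℝ) (hS : Adaptive S) (hSm : ∀ n, Measurable (S n))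
    (n : ℕ) {F : (ℕ × ι → ℝ) → ENNReal} (hF : Measurable F)
    (hdep : ∀ x x', SameObs S n x x' → F x = F x') :
    ∫⁻ x, F x ∂(pathLaw b)
      = ∫⁻ x, F x * ENNReal.ofReal (Real.exp (-logRatio a b S n x)) ∂(pathLaw a) := by
  classical
  have hW : ∀ n, Measurable fun x : ℕ × ι → ℝ =>
      ∏ i ∈ Finset.range n, ∏ k ∈ S i x, likelihood (a k) (b k) (x (i, k)) := by
    intro n
    refine Finset.measurable_prod _ fun i _ => ?_
    have : ∀ x : ℕ × ι → ℝ, ∏ k ∈ S i x, likelihood (a k) (b k) (x (i, k))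
        = ∏ k, if k ∈ S i x then likelihood (a k) (b k) (x (i, k)) else 1 := fun x => by
      simp [Finset.prod_ite_mem]
    simp_rw [this]
    refine Finset.measurable_prod _ fun k _ => Measurable.ite ?_ ?_ measurable_const
    · exact (hSm i) (measurableSet_mem_finset k)
    · exact (measurable_likelihood _ _).comp (measurable_pi_apply _)
  simp_rw [ofReal_exp_neg_logRatio]
  induction n generalizing F with
  | zero =>
    have hc : ∀ x, F x = F 0 := fun x => hdep x 0 fun i hi => absurd hi (Nat.not_lt_zero i)
    simp [hc]
  | succ n ih =>
    have hS' : ∀ i ≤ n, ∀ x y, S i (resample n x y) = S i x := fun i hi x y => hS.resample_eq hi x y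
    have hres : ∀ {x x'} (y y' : ι → ℝ), SameObs S n x x' → (∀ k ∈ S n x, y k = y' k) →
        SameObs S (n + 1) (resample n x y) (resample n x' y') := by
      intro x x' y y' h hy i hi k hk
      rw [hS' i (Nat.lt_succ_iff.1 hi)] at hk
      rcases (Nat.lt_succ_iff.1 hi).lt_or_eq with hlt | rfl
      · simpa [resample, hlt.ne] using h i hlt k hk
      · simpa [resample] using hy k hk
    have hFr : Measurable fun p : (ℕ × ι → ℝ) × (ι → ℝ) => F (resample n p.1 p.2) :=
      hF.comp (measurable_resample n)
    rw [lintegral_resample n b hF, ih (F := fun x => ∫⁻ y, F (resample n x y) ∂(stepLaw b))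
      hFr.lintegral_prod_right' fun x x' h => lintegral_congr fun y =>
        hdep _ _ (hres y y h fun _ _ => rfl), lintegral_resample n a
        (F := fun x => F x * ∏ i ∈ Finset.range (n + 1), ∏ k ∈ S i x,
          likelihood (a k) (b k) (x (i, k))) (hF.mul (hW (n + 1)))]
    refine lintegral_congr fun x => ?_
    -- The unobserved rewards of time `n` do not enter `F`, so that only the observed ones
    -- contribute to the density.
    rw [lintegral_stepLaw_change a b (S n x) (F := fun y => F (resample n x y))
        (hFr.comp measurable_prodMk_left)
        fun y y' h => hdep _ _ (hres y y' (fun _ _ _ _ => rfl) h),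
      ← lintegral_mul_const']
    · refine lintegral_congr fun y => ?_
      simp only [Finset.prod_range_succ]
      rw [hS' n le_rfl]
      have : ∏ i ∈ Finset.range n, ∏ k ∈ S i (resample n x y),
            likelihood (a k) (b k) (resample n x y (i, k))
          = ∏ i ∈ Finset.range n, ∏ k ∈ S i x, likelihood (a k) (b k) (x (i, k)) := by
        refine Finset.prod_congr rfl fun i hi => ?_
        rw [hS' i (Finset.mem_range.1 hi).le]
        refine Finset.prod_congr rfl fun k _ => ?_
        simp [resample, (Finset.mem_range.1 hi).ne]
      rw [this]
      simp only [resample, if_true]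
      ring
    · exact (ENNReal.prod_lt_top fun i _ => ENNReal.prod_lt_top fun k _ =>
        ENNReal.ofReal_lt_top).ne

/-- The noise of an observation is centred, given the decision to observe. -/
lemma integral_observed_noise [DecidableEq ι] (a : ι → ℝ) (hS : Adaptive S)
    (hSm : ∀ n, Measurable (S n)) (n : ℕ) (k : ι) :
    ∫ x, (if k ∈ S n x then x (n, k) - a k else 0) ∂(pathLaw a) = 0 := by
  have hm : Measurable fun x : ℕ × ι → ℝ => if k ∈ S n x then x (n, k) - a k else 0 :=
    Measurable.ite ((hSm n) (measurableSet_mem_finset k)) (by fun_prop) measurable_const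
  have hint : Integrable (fun x : ℕ × ι → ℝ => if k ∈ S n x then x (n, k) - a k else 0)
      (pathLaw a) := by
    refine (integrable_sub_mean a (n, k)).mono hm.aestronglyMeasurable (ae_of_all _ fun x => ?_)
    split_ifs <;> simp
  rw [← map_resample n a] at hint ⊢
  rw [integrable_map_measure hm.aestronglyMeasurable (measurable_resample n).aemeasurable] at hint
  rw [integral_map (measurable_resample n).aemeasurable hm.aestronglyMeasurable,
    integral_prod (fun p => if k ∈ S n (resample n p.1 p.2) then
      resample n p.1 p.2 (n, k) - a k else 0) hint]
  refine integral_eq_zero_of_ae (ae_of_all _ fun x => ?_)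
  simp only [hS.resample_eq le_rfl, resample, if_true, Pi.zero_apply]
  split_ifs with h
  · have hp := measurePreserving_eval (fun i => gaussianReal (a i) 1) k
    have : ∫ y : ι → ℝ, (y k - a k) ∂(stepLaw a) = ∫ z, (z - a k) ∂(gaussianReal (a k) 1) := by
      rw [← hp.map_eq, integral_map hp.measurable.aemeasurable (by fun_prop)]
    have hid : Integrable (fun z : ℝ => z) (gaussianReal (a k) 1) :=
      (memLp_id_gaussianReal 1).integrable le_rfl
    rw [this, integral_sub hid (integrable_const _)]
    simp [integral_id_gaussianReal]
  · simp

end Adaptive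

/-! ### Adaptive sampling with a random seed -/

section Randomised
variable {ι U : Type*} [Fintype ι] [MeasurableSpace U]

lemma measurable_logRatio {S : ℕ → U × (ℕ × ι → ℝ) → Finset ι} (hSm : ∀ n, Measurable (S n))
    (a b : ι → ℝ) (n : ℕ) :
    Measurable fun ω : U × (ℕ × ι → ℝ) => logRatio a b (fun i x => S i (ω.1, x)) n ω.2 := by
  classical
  simp_rw [logRatio_eq_sum_ite]
  refine Finset.measurable_sum _ fun i _ => Finset.measurable_sum _ fun k _ => ?_
  exact Measurable.ite ((hSm i) (measurableSet_mem_finset k)) (by fun_prop) measurable_const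

lemma integrable_logRatio {S : ℕ → U × (ℕ × ι → ℝ) → Finset ι} (hSm : ∀ n, Measurable (S n))
    (Q : Measure U) [IsProbabilityMeasure Q] (a b : ι → ℝ) (n : ℕ) :
    Integrable (fun ω : U × (ℕ × ι → ℝ) => logRatio a b (fun i x => S i (ω.1, x)) n ω.2)
      (Q.prod (pathLaw a)) := by
  classical
  simp_rw [logRatio_eq_sum_ite]
  refine integrable_finsetSum _ fun i _ => integrable_finsetSum _ fun k _ => ?_
  have hm : Measurable fun ω : U × (ℕ × ι → ℝ) => if k ∈ S i (ω.1, ω.2) then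
      (a k - b k) * (ω.2 (i, k) - a k) + (a k - b k) ^ 2 / 2 else 0 :=
    Measurable.ite ((hSm i) (measurableSet_mem_finset k)) (by fun_prop) measurable_const
  have hi : Integrable (fun ω : U × (ℕ × ι → ℝ) =>
      (a k - b k) * (ω.2 (i, k) - a k) + (a k - b k) ^ 2 / 2) (Q.prod (pathLaw a)) :=
    (((integrable_sub_mean a (i, k)).comp_snd Q).const_mul _).add (integrable_const _)
  refine hi.mono hm.aestronglyMeasurable (ae_of_all _ fun ω => ?_)
  split_ifs <;> simp

/-- Wald's identity: an observation of arm `k` contributes `(a k - b k) ^ 2 / 2` to the expected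
log-likelihood ratio. -/
lemma integral_logRatio {S : ℕ → U × (ℕ × ι → ℝ) → Finset ι} (hSm : ∀ n, Measurable (S n))
    (hS : ∀ u, Adaptive fun i x => S i (u, x))
    (Q : Measure U) [IsProbabilityMeasure Q] (a b : ι → ℝ) (n : ℕ) :
    ∫ ω, logRatio a b (fun i x => S i (ω.1, x)) n ω.2 ∂(Q.prod (pathLaw a))
      = ∑ k, (a k - b k) ^ 2 / 2 *
          ∑ i ∈ Finset.range n, (Q.prod (pathLaw a)).real {ω | k ∈ S i ω} := by
  classical
  have hmS : ∀ i k, MeasurableSet {ω | k ∈ S i ω} := fun i k =>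
    (hSm i) (measurableSet_mem_finset k)
  have hnm : ∀ i k, Measurable fun ω : U × (ℕ × ι → ℝ) =>
      if k ∈ S i ω then ω.2 (i, k) - a k else 0 := fun i k =>
    Measurable.ite (hmS i k) (by fun_prop) measurable_const
  have hni : ∀ i k, Integrable (fun ω : U × (ℕ × ι → ℝ) =>
      if k ∈ S i ω then ω.2 (i, k) - a k else 0) (Q.prod (pathLaw a)) := fun i k => by
    refine ((integrable_sub_mean a (i, k)).comp_snd Q).mono (hnm i k).aestronglyMeasurable
      (ae_of_all _ fun ω => ?_)
    split_ifs <;> simp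
  have hn0 : ∀ i k, ∫ ω : U × (ℕ × ι → ℝ),
      (if k ∈ S i ω then ω.2 (i, k) - a k else 0) ∂(Q.prod (pathLaw a)) = 0 := fun i k => by
    rw [integral_prod _ (hni i k)]
    refine integral_eq_zero_of_ae (ae_of_all _ fun u => ?_)
    exact integral_observed_noise a (hS u) (fun n => (hSm n).comp measurable_prodMk_left) i k
  have hci : ∀ i k, Integrable ({ω | k ∈ S i ω}.indicator fun _ => (1 : ℝ))
      (Q.prod (pathLaw a)) := fun i k => (integrable_const _).indicator (hmS i k)
  have hterm : ∀ i k (ω : U × (ℕ × ι → ℝ)), (if k ∈ S i (ω.1, ω.2) then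
      (a k - b k) * (ω.2 (i, k) - a k) + (a k - b k) ^ 2 / 2 else 0)
      = (a k - b k) * (if k ∈ S i ω then ω.2 (i, k) - a k else 0)
        + (a k - b k) ^ 2 / 2 * {ω | k ∈ S i ω}.indicator (fun _ => (1 : ℝ)) ω := by
    intro i k ω
    by_cases h : k ∈ S i ω <;> simp [h]
  have hti : ∀ i k, Integrable (fun ω : U × (ℕ × ι → ℝ) =>
      (a k - b k) * (if k ∈ S i ω then ω.2 (i, k) - a k else 0)
        + (a k - b k) ^ 2 / 2 * {ω | k ∈ S i ω}.indicator (fun _ => (1 : ℝ)) ω)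
      (Q.prod (pathLaw a)) := fun i k => ((hni i k).const_mul _).add ((hci i k).const_mul _)
  simp_rw [logRatio_eq_sum_ite, hterm]
  rw [integral_finsetSum _ fun i _ => integrable_finsetSum _ fun k _ => hti i k,
    Finset.sum_congr rfl fun i _ => integral_finsetSum _ fun k _ => hti i k, Finset.sum_comm]
  refine Finset.sum_congr rfl fun k _ => ?_
  rw [Finset.mul_sum]
  refine Finset.sum_congr rfl fun i _ => ?_
  rw [integral_add ((hni i k).const_mul _) ((hci i k).const_mul _), integral_const_mul,
    integral_const_mul, hn0, integral_indicator_const _ (hmS i k)]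
  simp

/-- The change of measure of an event `A` decided by the observations before time `n`: a
Donsker-Varadhan bound with the test function `c` on `A` and `0` elsewhere. -/
theorem mul_prob_sub_le_log {S : ℕ → U × (ℕ × ι → ℝ) → Finset ι} (hSm : ∀ n, Measurable (S n))
    (hS : ∀ u, Adaptive fun i x => S i (u, x))
    (Q : Measure U) [IsProbabilityMeasure Q] (a b : ι → ℝ) (n : ℕ)
    {A : Set (U × (ℕ × ι → ℝ))} (hA : MeasurableSet A)
    (hAdep : ∀ u x x', SameObs (fun i x => S i (u, x)) n x x' → ((u, x) ∈ A ↔ (u, x') ∈ A))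
    (c : ℝ) :
    c * (Q.prod (pathLaw a)).real A
        - ∑ k, (a k - b k) ^ 2 / 2 *
          ∑ i ∈ Finset.range n, (Q.prod (pathLaw a)).real {ω | k ∈ S i ω}
      ≤ Real.log (1 + (Real.exp c - 1) * (Q.prod (pathLaw b)).real A) := by
  classical
  let L : U × (ℕ × ι → ℝ) → ℝ := fun ω => logRatio a b (fun i x => S i (ω.1, x)) n ω.2
  let g : U × (ℕ × ι → ℝ) → ℝ := A.indicator fun _ => c
  have hg : Measurable g := measurable_const.indicator hA
  have hL : Measurable L := measurable_logRatio hSm a b n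
  have hgi : Integrable g (Q.prod (pathLaw a)) := (integrable_const _).indicator hA
  have hLi : Integrable L (Q.prod (pathLaw a)) := integrable_logRatio hSm Q a b n
  have hexp : ∀ ω, Real.exp (g ω) = 1 + A.indicator (fun _ => Real.exp c - 1) ω := by
    intro ω
    by_cases h : ω ∈ A <;> simp [g, h]
  have hexpi : Integrable (fun ω => Real.exp (g ω)) (Q.prod (pathLaw b)) := by
    simp_rw [hexp]
    exact (integrable_const _).add ((integrable_const _).indicator hA)
  have hchange : ∫⁻ ω, ENNReal.ofReal (Real.exp (g ω)) ∂(Q.prod (pathLaw b))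
      = ∫⁻ ω, ENNReal.ofReal (Real.exp (g ω - L ω)) ∂(Q.prod (pathLaw a)) := by
    rw [lintegral_prod _ (by fun_prop), lintegral_prod _ (by fun_prop)]
    refine lintegral_congr fun u => ?_
    rw [lintegral_pathLaw_change a b (hS u) (fun n => (hSm n).comp measurable_prodMk_left) n
      (F := fun x => ENNReal.ofReal (Real.exp (g (u, x)))) (by fun_prop)]
    · refine lintegral_congr fun x => ?_
      rw [← ENNReal.ofReal_mul (Real.exp_pos _).le, ← Real.exp_add]
      rfl
    · intro x x' h
      simp only [g, Set.indicator_apply, hAdep u x x' h]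
  have hVi : Integrable (fun ω => Real.exp (g ω - L ω)) (Q.prod (pathLaw a)) := by
    refine ⟨by fun_prop, ?_⟩
    rw [hasFiniteIntegral_iff_ofReal (ae_of_all _ fun ω => (Real.exp_pos _).le), ← hchange,
      ← hasFiniteIntegral_iff_ofReal (ae_of_all _ fun ω => (Real.exp_pos _).le)]
    exact hexpi.2
  have hint : ∫ ω, Real.exp (g ω - L ω) ∂(Q.prod (pathLaw a))
      = 1 + (Real.exp c - 1) * (Q.prod (pathLaw b)).real A := by
    rw [integral_eq_lintegral_of_nonneg_ae (ae_of_all _ fun ω => (Real.exp_pos _).le)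
      hVi.aestronglyMeasurable, ← hchange, ← integral_eq_lintegral_of_nonneg_ae
      (ae_of_all _ fun ω => (Real.exp_pos _).le) hexpi.aestronglyMeasurable]
    simp_rw [hexp]
    rw [integral_add (integrable_const _) ((integrable_const _).indicator hA),
      integral_indicator_const _ hA]
    simp [mul_comm]
  have hjensen : Real.exp (∫ ω, (g ω - L ω) ∂(Q.prod (pathLaw a)))
      ≤ ∫ ω, Real.exp (g ω - L ω) ∂(Q.prod (pathLaw a)) :=
    convexOn_exp.map_integral_le Real.continuous_exp.continuousOn isClosed_univ
      (ae_of_all _ fun _ => trivial) (hgi.sub hLi) hVi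
  rw [hint, integral_sub hgi hLi, integral_indicator_const _ hA, integral_logRatio hSm hS] at hjensen
  rw [Real.le_log_iff_exp_le ((Real.exp_pos _).trans_le hjensen)]
  simpa [mul_comm] using hjensen

end Randomised

/-! ### The run of an algorithm as adaptive sampling -/

lemma measurable_snoc {Ω α : Type*} [MeasurableSpace Ω] [MeasurableSpace α] {n : ℕ}
    {f : Ω → Fin n → α} {g : Ω → α} (hf : Measurable f) (hg : Measurable g) :
    Measurable fun ω => Fin.snoc (α := fun _ => α) (f ω) (g ω) := by
  refine measurable_pi_lambda _ fun i => ?_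
  induction i using Fin.lastCases with
  | last => simpa using hg
  | cast i =>
    simp only [Fin.snoc_castSucc]
    exact (measurable_pi_apply i).comp hf

namespace Algorithm

variable {K M : ℕ} (π : Algorithm K M)

lemma measurable_chosen {n : ℕ} {h : π.Sample → Fin n → Step K M π.Up π.Down}
    (hh : Measurable h) (m : Fin M) : Measurable fun ω => π.chosen ω.1 n (h ω) m := by
  refine (π.select_measurable n m).comp (measurable_fst.prodMk (Measurable.prodMk ?_ ?_)) <;>
  exact measurable_pi_lambda _ fun i => by fun_prop

lemma measurable_next {n : ℕ} {h : π.Sample → Fin n → Step K M π.Up π.Down}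
    (hh : Measurable h) : Measurable fun ω => π.next ω n (h ω) := by
  have hobs : Measurable fun ω : π.Sample => fun (m : Fin M) (k : Fin K) =>
      if k ∈ π.chosen ω.1 n (h ω) m then (Sum.inl (ω.2 (n, k, m)) : ℝ ⊕ Unit)
        else Sum.inr () := by
    refine measurable_pi_lambda _ fun m => measurable_pi_lambda _ fun k => ?_
    refine Measurable.ite ?_ (measurable_inl.comp (by fun_prop)) measurable_const
    exact π.measurable_chosen hh m (measurableSet_mem_finset k)
  have hup : Measurable fun ω : π.Sample => fun m => π.send n m (ω.1,
      Fin.snoc (α := fun _ => Obs K) (fun i => (h ω i).1 m) (fun k =>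
        if k ∈ π.chosen ω.1 n (h ω) m then (Sum.inl (ω.2 (n, k, m)) : ℝ ⊕ Unit)
          else Sum.inr ()), fun i => (h ω i).2.2 m) := by
    refine measurable_pi_lambda _ fun m => (π.send_measurable n m).comp
      (measurable_fst.prodMk (Measurable.prodMk (measurable_snoc ?_ ?_) ?_))
    · exact measurable_pi_lambda _ fun i => by fun_prop
    · exact (measurable_pi_apply m).comp hobs
    · exact measurable_pi_lambda _ fun i => by fun_prop
  refine hobs.prodMk (hup.prodMk (measurable_pi_lambda _ fun m => ?_))
  refine (π.reply_measurable n m).comp (measurable_fst.prodMk (measurable_snoc ?_ hup))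
  exact measurable_pi_lambda _ fun i => by fun_prop

lemma measurable_hist (n : ℕ) : Measurable fun ω => π.hist ω n := by
  induction n with
  | zero => exact measurable_pi_lambda _ fun i => i.elim0
  | succ n ih => exact measurable_snoc ih (π.measurable_next ih)

lemma measurableSet_stopsAt (n : ℕ) : MeasurableSet {ω | π.StopsAt ω n} :=
  ((π.halt_measurable n).comp (measurable_fst.prodMk (π.measurable_hist n)))
    (measurableSet_singleton true)

lemma measurableSet_running (n : ℕ) : MeasurableSet {ω | π.Running ω n} := by
  have : {ω | π.Running ω n} = ⋂ j ≤ n, {ω | π.StopsAt ω j}ᶜ := by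
    ext ω; simp [Running]
  rw [this]
  exact MeasurableSet.iInter fun j => MeasurableSet.iInter fun _ =>
    (π.measurableSet_stopsAt j).compl

open Classical in
/-- The arms `(k, m)` that are selected in time step `n`, if this step is carried out. -/
def sampled (n : ℕ) (ω : π.Sample) : Finset (Fin K × Fin M) :=
  if π.Running ω n then
    Finset.univ.filter fun p => p.1 ∈ π.chosen ω.1 n (π.hist ω n) p.2
  else ∅

lemma mem_sampled {n : ℕ} {ω : π.Sample} {p : Fin K × Fin M} :
    p ∈ π.sampled n ω ↔ π.Running ω n ∧ p.1 ∈ π.chosen ω.1 n (π.hist ω n) p.2 := by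
  by_cases h : π.Running ω n <;> simp [sampled, h]

lemma measurableSet_mem_sampled (n : ℕ) (p : Fin K × Fin M) :
    MeasurableSet {ω | p ∈ π.sampled n ω} := by
  simp_rw [mem_sampled]
  exact (π.measurableSet_running n).inter
    (π.measurable_chosen (π.measurable_hist n) p.2 (measurableSet_mem_finset p.1))

lemma measurable_sampled (n : ℕ) : Measurable (π.sampled n) :=
  measurable_finset_iff.2 fun p => measurable_to_prop (by
    have : (fun ω => p ∈ π.sampled n ω) ⁻¹' {True} = {ω | p ∈ π.sampled n ω} := by
      ext; simp
    rw [this]; exact π.measurableSet_mem_sampled n p)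

section Congr
variable {π} {u : π.Seed} {x x' : ℕ × Fin K × Fin M → ℝ} {n : ℕ}

/-- Up to termination, the history is a function of the seed and the observed rewards. -/
lemma hist_congr (h : SameObs (fun i x => π.sampled i (u, x)) n x x') :
    ∀ j ≤ n, (∀ i < j, ¬ π.StopsAt (u, x) i) → π.hist (u, x) j = π.hist (u, x') j := by
  intro j
  induction j with
  | zero => intro _ _; rfl
  | succ j ih =>
    intro hj hrun
    have hh := ih (by omega) fun i hi => hrun i (by omega)
    have hR : π.Running (u, x) j := fun i hi => hrun i (by omega)
    have hobs : (fun (m : Fin M) (k : Fin K) => if k ∈ π.chosen u j (π.hist (u, x) j) m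
          then (Sum.inl (x (j, k, m)) : ℝ ⊕ Unit) else Sum.inr ())
        = fun m k => if k ∈ π.chosen u j (π.hist (u, x) j) m
          then Sum.inl (x' (j, k, m)) else Sum.inr () := by
      funext m k
      split_ifs with hk
      · exact congrArg _ (h j (by omega) (k, m) (π.mem_sampled.2 ⟨hR, hk⟩))
      · rfl
    have hnext : π.next (u, x) j (π.hist (u, x) j) = π.next (u, x') j (π.hist (u, x) j) := by
      have hobs' := fun m => congrFun hobs m
      simp only [next, hobs']
      rw [hobs]
    simp only [hist]
    rw [hnext, hh]

lemma forall_not_stopsAt_congr (h : SameObs (fun i x => π.sampled i (u, x)) n x x') :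
    ∀ j ≤ n + 1, (∀ i < j, ¬ π.StopsAt (u, x) i) ↔ ∀ i < j, ¬ π.StopsAt (u, x') i := by
  intro j
  induction j with
  | zero => intro _; simp
  | succ j ih =>
    intro hj
    have ih := ih (by omega)
    rw [Nat.forall_lt_succ_right, Nat.forall_lt_succ_right, ih]
    refine and_congr_right fun hrun => ?_
    rw [StopsAt, StopsAt, hist_congr h j (by omega) (ih.2 hrun)]

lemma running_congr (h : SameObs (fun i x => π.sampled i (u, x)) n x x') :
    π.Running (u, x) n ↔ π.Running (u, x') n := by
  simpa only [Running, Nat.lt_succ_iff] using forall_not_stopsAt_congr h (n + 1) le_rfl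

end Congr

lemma adaptive_sampled (u : π.Seed) : Adaptive fun i x => π.sampled i (u, x) := by
  intro n x x' h
  ext p
  simp only [mem_sampled]
  rw [← running_congr h]
  refine and_congr_right fun hR => ?_
  rw [hist_congr h n le_rfl fun i hi => hR i hi.le]

/-- The algorithm terminates after at most `n` time steps, and declares `s`. -/
def DeclaresBy (n : ℕ) (s : Answer K M) (ω : π.Sample) : Prop :=
  ∃ j ≤ n, (∀ i < j, ¬ π.StopsAt ω i) ∧ π.StopsAt ω j ∧ π.output j (ω.1, π.hist ω j) = s

lemma measurableSet_declaresBy (n : ℕ) (s : Answer K M) :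
    MeasurableSet {ω | π.DeclaresBy n s ω} := by
  have : {ω | π.DeclaresBy n s ω} = ⋃ j ≤ n, ((⋂ i < j, {ω | π.StopsAt ω i}ᶜ) ∩
      ({ω | π.StopsAt ω j} ∩ {ω | π.output j (ω.1, π.hist ω j) = s})) := by
    ext ω
    simp only [DeclaresBy, Set.mem_ofPred_eq, Set.mem_iUnion, Set.mem_inter_iff, Set.mem_iInter,
      Set.mem_compl_iff, exists_prop]
  rw [this]
  refine MeasurableSet.iUnion fun j => MeasurableSet.iUnion fun _ => ?_
  refine (MeasurableSet.iInter fun i => MeasurableSet.iInter fun _ =>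
    (π.measurableSet_stopsAt i).compl).inter ((π.measurableSet_stopsAt j).inter ?_)
  exact ((π.output_measurable j).comp (measurable_fst.prodMk (π.measurable_hist j)))
    (measurableSet_singleton s)

lemma declaresBy_congr {u : π.Seed} {x x' : ℕ × Fin K × Fin M → ℝ} {n : ℕ} (s : Answer K M)
    (h : SameObs (fun i x => π.sampled i (u, x)) n x x') :
    π.DeclaresBy n s (u, x) ↔ π.DeclaresBy n s (u, x') := by
  refine exists_congr fun j => and_congr_right fun hj => ?_
  rw [← forall_not_stopsAt_congr h j (by omega)]
  refine and_congr_right fun hrun => ?_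
  rw [StopsAt, StopsAt, hist_congr h j hj hrun]

lemma setOf_declares_eq_iUnion (s : Answer K M) :
    {ω | π.Declares ω s} = ⋃ n, {ω | π.DeclaresBy n s ω} := by
  ext ω
  simp only [Set.mem_ofPred_eq, Set.mem_iUnion]
  constructor
  · rintro ⟨n, h1, h2, h3⟩
    exact ⟨n, n, le_rfl, h2, h1, h3⟩
  · rintro ⟨_, j, _, h2, h1, h3⟩
    exact ⟨j, h1, h2, h3⟩

lemma monotone_declaresBy (s : Answer K M) : Monotone fun n => {ω | π.DeclaresBy n s ω} :=
  fun _ _ hab _ ⟨j, hj, h⟩ => ⟨j, hj.trans hab, h⟩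

lemma measurableSet_declares (s : Answer K M) : MeasurableSet {ω | π.Declares ω s} := by
  rw [setOf_declares_eq_iUnion]
  exact MeasurableSet.iUnion fun n => π.measurableSet_declaresBy n s

lemma eq_of_declares {ω : π.Sample} {s s' : Answer K M} (h : π.Declares ω s)
    (h' : π.Declares ω s') : s = s' := by
  obtain ⟨n, h1, h2, h3⟩ := h
  obtain ⟨n', h1', h2', h3'⟩ := h'
  rcases lt_trichotomy n n' with hlt | rfl | hlt
  · exact absurd h1 (h2' n hlt)
  · exact h3.symm.trans h3'
  · exact absurd h1' (h2 n' hlt)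

instance (μ : Instance K M) : IsProbabilityMeasure (π.law μ) := by
  unfold law; infer_instance

variable {π}

lemma IsPAC.le_prob {δ : ℝ} (hπ : π.IsPAC δ) {μ : Instance K M} {s : Answer K M}
    (hs : IsAnswer μ s) : 1 - δ ≤ (π.law μ).real {ω | π.Declares ω s} :=
  (ENNReal.ofReal_le_iff_le_toReal (measure_ne_top _ _)).1 (hπ μ s hs)

lemma IsPAC.prob_le {δ : ℝ} (hπ : π.IsPAC δ) {μ : Instance K M} {s s' : Answer K M}
    (hs : IsAnswer μ s) (hne : s' ≠ s) : (π.law μ).real {ω | π.Declares ω s'} ≤ δ := by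
  have h1 := hπ.le_prob hs
  have h2 : (π.law μ).real {ω | π.Declares ω s'} ≤ (π.law μ).real {ω | π.Declares ω s}ᶜ :=
    measureReal_mono fun ω h' h => hne (π.eq_of_declares h' h)
  rw [probReal_compl_eq_one_sub (π.measurableSet_declares s)] at h2
  linarith

variable (π)

/-! ### Expected numbers of selections -/

/-- The expected number of selections of arm `k` of client `m` until termination. -/
def meanPulls (μ : Instance K M) (k : Fin K) (m : Fin M) : ENNReal :=
  ∫⁻ ω, π.pulls ω k m ∂(π.law μ)

lemma pulls_eq_tsum_indicator (ω : π.Sample) (k : Fin K) (m : Fin M) :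
    π.pulls ω k m = ∑' n, {ω | (k, m) ∈ π.sampled n ω}.indicator 1 ω := by
  classical
  simp only [pulls, mem_sampled]
  refine tsum_congr fun n => ?_
  by_cases h : π.Running ω n ∧ k ∈ π.chosen ω.1 n (π.hist ω n) m
  · rw [if_pos h, Set.indicator_of_mem (by exact h), Pi.one_apply]
  · rw [if_neg h, Set.indicator_of_notMem (by exact h)]

lemma measurable_pulls (k : Fin K) (m : Fin M) : Measurable fun ω => π.pulls ω k m := by
  simp_rw [pulls_eq_tsum_indicator]
  exact Measurable.tsum fun n =>
    measurable_one.indicator (π.measurableSet_mem_sampled n (k, m))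

lemma meanPulls_eq_tsum (μ : Instance K M) (k : Fin K) (m : Fin M) :
    π.meanPulls μ k m = ∑' n, π.law μ {ω | (k, m) ∈ π.sampled n ω} := by
  simp_rw [meanPulls, pulls_eq_tsum_indicator]
  rw [lintegral_tsum fun n =>
    (measurable_one.indicator (π.measurableSet_mem_sampled n (k, m))).aemeasurable]
  exact tsum_congr fun n => lintegral_indicator_one (π.measurableSet_mem_sampled n (k, m))

lemma expectedPulls_eq_sum (μ : Instance K M) :
    π.expectedPulls μ = ∑ k, ∑ m, π.meanPulls μ k m := by
  simp only [expectedPulls, totalPulls]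
  rw [lintegral_finsetSum _ fun k _ => Finset.measurable_sum _ fun m _ => π.measurable_pulls k m]
  exact Finset.sum_congr rfl fun k _ => lintegral_finsetSum _ fun m _ => π.measurable_pulls k m

lemma sum_prob_sampled_le {μ : Instance K M} {k : Fin K} {m : Fin M}
    (hfin : π.meanPulls μ k m ≠ ⊤) (n : ℕ) :
    ∑ i ∈ Finset.range n, (π.law μ).real {ω | (k, m) ∈ π.sampled i ω}
      ≤ (π.meanPulls μ k m).toReal := by
  simp only [Measure.real]
  rw [← ENNReal.toReal_sum fun i _ => measure_ne_top _ _]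
  refine ENNReal.toReal_mono hfin ?_
  rw [meanPulls_eq_tsum]
  exact ENNReal.sum_le_tsum _

variable {π}

/-- A `δ`-PAC algorithm has to observe enough to tell apart two instances with different answers,
in the form that the test function `c` on the event of declaring `s` gives. -/
theorem IsPAC.mul_sub_sum_le_log {δ : ℝ} (hπ : π.IsPAC δ) {μ ν : Instance K M}
    {s s' : Answer K M} (hs : IsAnswer μ s) (hs' : IsAnswer ν s') (hne : s ≠ s')
    (hfin : ∀ k m, π.meanPulls μ k m ≠ ⊤) {c : ℝ} (hc : 0 ≤ c) :
    c * (1 - δ) - ∑ p : Fin K × Fin M,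
        (μ p.1 p.2 - ν p.1 p.2) ^ 2 / 2 * (π.meanPulls μ p.1 p.2).toReal
      ≤ Real.log (1 + (Real.exp c - 1) * δ) := by
  have hec : 0 ≤ Real.exp c - 1 := by linarith [Real.add_one_le_exp c]
  have hn : ∀ n, c * (π.law μ).real {ω | π.DeclaresBy n s ω} - ∑ p : Fin K × Fin M,
        (μ p.1 p.2 - ν p.1 p.2) ^ 2 / 2 * (π.meanPulls μ p.1 p.2).toReal
      ≤ Real.log (1 + (Real.exp c - 1) * δ) := by
    intro n
    have h := mul_prob_sub_le_log π.measurable_sampled π.adaptive_sampled π.seedLaw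
      (fun p : Fin K × Fin M => μ p.1 p.2) (fun p => ν p.1 p.2) n
      (π.measurableSet_declaresBy n s) (fun u x x' h => π.declaresBy_congr s h) c
    have h1 : ∑ p : Fin K × Fin M, (μ p.1 p.2 - ν p.1 p.2) ^ 2 / 2 *
          ∑ i ∈ Finset.range n, (π.law μ).real {ω | p ∈ π.sampled i ω}
        ≤ ∑ p : Fin K × Fin M,
          (μ p.1 p.2 - ν p.1 p.2) ^ 2 / 2 * (π.meanPulls μ p.1 p.2).toReal :=
      Finset.sum_le_sum fun p _ => mul_le_mul_of_nonneg_left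
        (π.sum_prob_sampled_le (hfin p.1 p.2) n) (by positivity)
    have h2 : (π.law ν).real {ω | π.DeclaresBy n s ω} ≤ δ :=
      (measureReal_mono (by
        rw [setOf_declares_eq_iUnion]
        exact Set.subset_iUnion (fun n => {ω | π.DeclaresBy n s ω}) n)).trans
        (hπ.prob_le hs' hne)
    have h3 : Real.log (1 + (Real.exp c - 1) * (π.law ν).real {ω | π.DeclaresBy n s ω})
        ≤ Real.log (1 + (Real.exp c - 1) * δ) :=
      Real.log_le_log (by positivity) (by gcongr)
    exact ((sub_le_sub_left h1 _).trans h).trans h3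
  have hlim : Filter.Tendsto (fun n => (π.law μ).real {ω | π.DeclaresBy n s ω}) Filter.atTop
      (nhds ((π.law μ).real {ω | π.Declares ω s})) := by
    rw [setOf_declares_eq_iUnion]
    exact (ENNReal.tendsto_toReal (measure_ne_top _ _)).comp
      (tendsto_measure_iUnion_atTop (π.monotone_declaresBy s))
  have := le_of_tendsto' ((hlim.const_mul c).sub_const _) hn
  linarith [mul_le_mul_of_nonneg_left (hπ.le_prob hs) hc]

end Algorithm

/-! ### Numerical bound on the relative entropy -/

lemma log_le_two_mul_one_sub_two_mul_log {δ : ℝ} (hδ0 : 0 < δ) (hδ : 2.4 * δ < 1) :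
    Real.log (1 / (2.4 * δ)) ≤ 2 * ((1 - 2 * δ) * Real.log ((1 - δ) / δ)) := by
  have hδ1 : 0 < 1 - δ := by linarith
  rcases le_or_gt δ (1 / 4) with h4 | h4
  · -- The right side minus the left is
    -- `(1 - 4 * δ) * (-log δ) + log 2.4 + 2 * (1 - 2 * δ) * log (1 - δ)`.
    have h1 : -(δ / (1 - δ)) ≤ Real.log (1 - δ) := by
      have := Real.one_sub_inv_le_log_of_pos hδ1
      have e : 1 - (1 - δ)⁻¹ = -(δ / (1 - δ)) := by field_simp; ring
      rwa [e] at this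
    have h2 : 1 - 1 / 2.4 ≤ Real.log 2.4 := by
      have := Real.one_sub_inv_le_log_of_pos (show (0 : ℝ) < 2.4 by norm_num)
      rwa [← one_div] at this
    have h3 : Real.log δ ≤ 0 := Real.log_nonpos hδ0.le (by linarith)
    have h5 : δ / (1 - δ) ≤ 1 / 3 := by
      rw [div_le_iff₀ hδ1]; linarith
    rw [Real.log_div hδ1.ne' hδ0.ne', one_div, Real.log_inv,
      Real.log_mul (by norm_num) hδ0.ne']
    have h6 : δ / (1 - δ) * (1 - 2 * δ) ≤ δ := by
      rw [div_mul_eq_mul_div, div_le_iff₀ hδ1]; nlinarith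
    norm_num at h2
    nlinarith [mul_nonneg (show 0 ≤ 1 - 4 * δ by linarith) (neg_nonneg.2 h3),
      mul_le_mul_of_nonneg_right h1 (show 0 ≤ 1 - 2 * δ by linarith)]
  · have hu : Real.log (1 / (2.4 * δ)) ≤ 1 / (2.4 * δ) - 1 :=
      Real.log_le_sub_one_of_pos (by positivity)
    have hl : 1 - ((1 - δ) / δ)⁻¹ ≤ Real.log ((1 - δ) / δ) :=
      Real.one_sub_inv_le_log_of_pos (by positivity)
    have e : 1 - ((1 - δ) / δ)⁻¹ = (1 - 2 * δ) / (1 - δ) := by field_simp; ring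
    rw [e] at hl
    refine hu.trans (le_trans ?_ (mul_le_mul_of_nonneg_left
      (mul_le_mul_of_nonneg_left hl (by linarith)) (by norm_num)))
    have e2 : 2 * ((1 - 2 * δ) * ((1 - 2 * δ) / (1 - δ))) - (1 / (2.4 * δ) - 1)
        = (4.8 * δ * (1 - 2 * δ) ^ 2 - (1 - 2.4 * δ) * (1 - δ)) / (2.4 * δ * (1 - δ)) := by
      field_simp; ring
    rw [← sub_nonneg, e2]
    refine div_nonneg ?_ (by positivity)
    -- The numerator factors as `(δ - 1 / 4)` times a positive quadratic.
    have e3 : 4.8 * δ * (1 - 2 * δ) ^ 2 - (1 - 2.4 * δ) * (1 - δ)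
        = (δ - 1 / 4) * (19.2 * δ ^ 2 - 16.8 * δ + 4) := by ring
    rw [e3]
    exact mul_nonneg (by linarith) (by nlinarith [sq_nonneg (δ - 7 / 16)])

/-! ### Alternative instances -/

/-- The gap of `k` is positive, and any larger shift of the mean of arm `k`, in the direction `σ`
that depends on whether `k` is the best arm, makes another arm beat `b`. -/
lemma exists_shift_beats {K : ℕ} (hK : 1 < K) {v : Fin K → ℝ} {b : Fin K}
    (hb : ∀ j, j ≠ b → v j < v b) (k : Fin K) :
    0 < gap v b k ∧ ∃ σ : ℝ, σ ^ 2 = 1 ∧ ∀ t, gap v b k < t →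
      ∃ j, v b + (if b = k then σ * t else 0) < v j + (if j = k then σ * t else 0) := by
  by_cases hk : k = b
  · subst hk
    have : Nontrivial (Fin K) := Fin.nontrivial_iff_two_le.2 hK
    obtain ⟨j₀, hj₀⟩ := exists_ne k
    have : Nonempty {j : Fin K // j ≠ k} := ⟨⟨j₀, hj₀⟩⟩
    obtain ⟨⟨j, hj⟩, hmin⟩ := exists_eq_ciInf_of_finite (f := fun j : {j : Fin K // j ≠ k} => v k - v j)
    have hg : gap v k k = v k - v j := by rw [gap, if_pos rfl, ← hmin]
    refine ⟨by rw [hg]; linarith [hb j hj], -1, by norm_num, fun t ht => ⟨j, ?_⟩⟩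
    rw [hg] at ht
    simp only [if_true, if_neg hj]
    linarith
  · have hg : gap v b k = v b - v k := by rw [gap, if_neg hk]
    refine ⟨by rw [hg]; linarith [hb k hk], 1, by norm_num, fun t ht => ⟨k, ?_⟩⟩
    rw [hg] at ht
    simp only [if_true, if_neg (Ne.symm hk)]
    linarith

lemma eventually_add_mul_ne {a b : ℝ} (hab : a ≠ b) (x y : ℝ) :
    ∀ᶠ t in nhdsWithin (0 : ℝ) {0}ᶜ, x + t * a ≠ y + t * b := by
  by_cases hxy : x = y
  · filter_upwards [self_mem_nhdsWithin] with t ht h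
    rw [hxy, add_right_inj] at h
    exact hab (mul_left_cancel₀ ht h)
  · have hc : ContinuousAt (fun t : ℝ => (x + t * a) - (y + t * b)) 0 := by fun_prop
    have := hc.eventually_ne (y := 0) (by simpa [sub_eq_zero] using hxy)
    filter_upwards [nhdsWithin_le_nhds this] with t ht h
    exact ht (sub_eq_zero.2 h)

/-- The instance `ν`, with the means of all arms moved at pairwise different speeds, the same for all
clients. -/
def tilt {K M : ℕ} (ν : Instance K M) (t : ℝ) : Instance K M := fun k m => ν k m + t * (k : ℕ)

lemma globalMean_tilt {K M : ℕ} (hM : 0 < M) (ν : Instance K M) (t : ℝ) (k : Fin K) :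
    globalMean (tilt ν t) k = globalMean ν k + t * (k : ℕ) := by
  have : (M : ℝ) ≠ 0 := by positivity
  simp only [globalMean, tilt, Finset.sum_add_distrib, Finset.sum_const, Finset.card_univ,
    Fintype.card_fin, nsmul_eq_mul]
  field_simp

/-- Small tilts of any instance have unique best arms. -/
lemma eventually_exists_isAnswer_tilt {K M : ℕ} (hK : 0 < K) (hM : 0 < M) (ν : Instance K M) :
    ∀ᶠ t in nhdsWithin (0 : ℝ) {0}ᶜ, ∃ s', IsAnswer (tilt ν t) s' := by
  have hne : ∀ i j : Fin K, i ≠ j → ((i : ℕ) : ℝ) ≠ ((j : ℕ) : ℝ) := fun i j h h' =>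
    h (Fin.ext (Nat.cast_injective h'))
  have h1 : ∀ᶠ t in nhdsWithin (0 : ℝ) {0}ᶜ, ∀ m : Fin M, ∀ i j : Fin K, i ≠ j →
      tilt ν t i m ≠ tilt ν t j m := by
    simp only [Filter.eventually_all]
    exact fun m i j hij => eventually_add_mul_ne (hne i j hij) _ _
  have h2 : ∀ᶠ t in nhdsWithin (0 : ℝ) {0}ᶜ, ∀ i j : Fin K, i ≠ j →
      globalMean (tilt ν t) i ≠ globalMean (tilt ν t) j := by
    simp only [Filter.eventually_all, globalMean_tilt hM]
    exact fun i j hij => eventually_add_mul_ne (hne i j hij) _ _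
  have : Nonempty (Fin K) := ⟨⟨0, hK⟩⟩
  filter_upwards [h1, h2] with t ht1 ht2
  choose f hf using fun m => Finite.exists_max fun k => tilt ν t k m
  obtain ⟨g, hg⟩ := Finite.exists_max (globalMean (tilt ν t))
  exact ⟨(f, g), fun m j hj => (hf m j).lt_of_ne (ht1 m j _ hj),
    fun j hj => (hg j).lt_of_ne (ht2 j _ hj)⟩

/-- In `ν`, some arm is strictly better than the one that the answer `s` names. -/
def Beaten {K M : ℕ} (ν : Instance K M) (s : Answer K M) : Prop :=
  (∃ m j, ν (s.1 m) m < ν j m) ∨ ∃ j, globalMean ν s.2 < globalMean ν j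

lemma Beaten.not_isAnswer {K M : ℕ} {ν : Instance K M} {s : Answer K M} (h : Beaten ν s) :
    ¬ IsAnswer ν s := by
  intro hs
  rcases h with ⟨m, j, h⟩ | ⟨j, h⟩
  · by_cases hj : j = s.1 m
    · rw [hj] at h; exact lt_irrefl _ h
    · exact lt_asymm h (hs.1 m j hj)
  · by_cases hj : j = s.2
    · rw [hj] at h; exact lt_irrefl _ h
    · exact lt_asymm h (hs.2 j hj)

lemma Beaten.eventually_tilt {K M : ℕ} (hM : 0 < M) {ν : Instance K M} {s : Answer K M}
    (h : Beaten ν s) : ∀ᶠ t in nhds (0 : ℝ), Beaten (tilt ν t) s := by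
  rcases h with ⟨m, j, h⟩ | ⟨j, h⟩
  · have h1 : ContinuousAt (fun t => tilt ν t (s.1 m) m) 0 := by unfold tilt; fun_prop
    have h2 : ContinuousAt (fun t => tilt ν t j m) 0 := by unfold tilt; fun_prop
    filter_upwards [h1.eventually_lt h2 (by simpa [tilt] using h)] with t ht
    exact Or.inl ⟨m, j, ht⟩
  · have h1 : ∀ i, ContinuousAt (fun t => globalMean (tilt ν t) i) 0 := fun i => by
      simp_rw [globalMean_tilt hM]; fun_prop
    filter_upwards [(h1 s.2).eventually_lt (h1 j) (by simpa [globalMean_tilt hM] using h)] with t ht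
    exact Or.inr ⟨j, ht⟩

/-! ### Lower bounds on the numbers of selections -/

namespace Algorithm
variable {K M : ℕ} {π : Algorithm K M}

theorem IsPAC.log_le_sum {δ : ℝ} (hδ0 : 0 < δ) (hδ : 2.4 * δ < 1) (hπ : π.IsPAC δ)
    {μ ν : Instance K M} {s s' : Answer K M} (hs : IsAnswer μ s) (hs' : IsAnswer ν s')
    (hne : s ≠ s') (hfin : ∀ k m, π.meanPulls μ k m ≠ ⊤) :
    Real.log (1 / (2.4 * δ)) ≤ ∑ p : Fin K × Fin M,
        (μ p.1 p.2 - ν p.1 p.2) ^ 2 * (π.meanPulls μ p.1 p.2).toReal := by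
  have hδ1 : 0 < 1 - δ := by linarith
  have hr : 0 < (1 - δ) / δ := by positivity
  have hL : 0 ≤ Real.log ((1 - δ) / δ) :=
    Real.log_nonneg (by rw [le_div_iff₀ hδ0]; linarith)
  -- This `c` is the optimal test function: the log-odds of probability `1 - δ` against `δ`.
  have h := hπ.mul_sub_sum_le_log hs hs' hne hfin (c := 2 * Real.log ((1 - δ) / δ))
    (by positivity)
  have he : 1 + (Real.exp (2 * Real.log ((1 - δ) / δ)) - 1) * δ = (1 - δ) / δ := by
    rw [two_mul, Real.exp_add, Real.exp_log hr]
    field_simp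
    ring
  rw [he] at h
  have hsum : ∑ p : Fin K × Fin M,
        (μ p.1 p.2 - ν p.1 p.2) ^ 2 * (π.meanPulls μ p.1 p.2).toReal
      = 2 * ∑ p : Fin K × Fin M,
        (μ p.1 p.2 - ν p.1 p.2) ^ 2 / 2 * (π.meanPulls μ p.1 p.2).toReal := by
    rw [Finset.mul_sum]
    exact Finset.sum_congr rfl fun p _ => by ring
  rw [hsum]
  linarith [log_le_two_mul_one_sub_two_mul_log hδ0 hδ]

/-- Extension of `IsPAC.log_le_sum` to instances whose best arms need not be unique. -/
theorem IsPAC.log_le_sum_of_beaten {δ : ℝ} (hδ0 : 0 < δ) (hδ : 2.4 * δ < 1) (hπ : π.IsPAC δ)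
    (hK : 0 < K) (hM : 0 < M) {μ ν : Instance K M} {s : Answer K M} (hs : IsAnswer μ s)
    (hν : Beaten ν s) (hfin : ∀ k m, π.meanPulls μ k m ≠ ⊤) :
    Real.log (1 / (2.4 * δ)) ≤ ∑ p : Fin K × Fin M,
        (μ p.1 p.2 - ν p.1 p.2) ^ 2 * (π.meanPulls μ p.1 p.2).toReal := by
  have hcont : ContinuousAt (fun t => ∑ p : Fin K × Fin M,
      (μ p.1 p.2 - tilt ν t p.1 p.2) ^ 2 * (π.meanPulls μ p.1 p.2).toReal) 0 := by
    unfold tilt; fun_prop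
  have hlim := hcont.tendsto.mono_left (nhdsWithin_le_nhds (s := {0}ᶜ))
  simp only [show tilt ν 0 = ν by ext; simp [tilt]] at hlim
  refine ge_of_tendsto hlim ?_
  filter_upwards [nhdsWithin_le_nhds (hν.eventually_tilt hM),
    eventually_exists_isAnswer_tilt hK hM ν] with t ht ⟨s', hs'⟩
  exact hπ.log_le_sum hδ0 hδ hs hs' (fun h => ht.not_isAnswer (h ▸ hs')) hfin

/-- If every shift of the mean of arm `k` of client `m` by more than `g` in direction `σ` changes
the answer, then this arm is selected at least `log (1 / (2.4 * δ)) / g ^ 2` times on average. -/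
theorem IsPAC.div_sq_le_meanPulls {δ : ℝ} (hδ0 : 0 < δ) (hδ : 2.4 * δ < 1) (hπ : π.IsPAC δ)
    (hK : 0 < K) (hM : 0 < M) {μ : Instance K M} {s : Answer K M} (hs : IsAnswer μ s)
    (hfin : ∀ k m, π.meanPulls μ k m ≠ ⊤) (k : Fin K) (m : Fin M) {g σ : ℝ} (hg : 0 < g)
    (hσ : σ ^ 2 = 1)
    (hbeat : ∀ t, g < t → Beaten (fun i l => μ i l + if i = k ∧ l = m then σ * t else 0) s) :
    Real.log (1 / (2.4 * δ)) / g ^ 2 ≤ (π.meanPulls μ k m).toReal := by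
  have h : ∀ t, g < t → Real.log (1 / (2.4 * δ)) ≤ t ^ 2 * (π.meanPulls μ k m).toReal := by
    intro t ht
    have h := hπ.log_le_sum_of_beaten hδ0 hδ hK hM hs (hbeat t ht) hfin
    rw [Finset.sum_eq_single (k, m)] at h
    · simpa [mul_pow, hσ] using h
    · rintro ⟨i, l⟩ _ hp
      have : ¬ (i = k ∧ l = m) := fun h => hp (Prod.ext h.1 h.2)
      simp [this]
    · simp
  have hcont : ContinuousAt (fun t : ℝ => t ^ 2 * (π.meanPulls μ k m).toReal) g := by fun_prop
  have hlim := ge_of_tendsto (hcont.tendsto.mono_left (nhdsWithin_le_nhds (s := Set.Ioi g)))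
    (Filter.eventually_of_mem self_mem_nhdsWithin h)
  rw [div_le_iff₀ (by positivity)]
  linarith

theorem IsPAC.div_localGap_sq_le_meanPulls {δ : ℝ} (hδ0 : 0 < δ) (hδ : 2.4 * δ < 1)
    (hπ : π.IsPAC δ) (hK : 1 < K) (hM : 0 < M) {μ : Instance K M} {s : Answer K M}
    (hs : IsAnswer μ s) (hfin : ∀ k m, π.meanPulls μ k m ≠ ⊤) (k : Fin K) (m : Fin M) :
    Real.log (1 / (2.4 * δ)) / localGap μ s k m ^ 2 ≤ (π.meanPulls μ k m).toReal := by
  obtain ⟨hg, σ, hσ, hbeat⟩ := exists_shift_beats hK (v := fun j => μ j m) (hs.1 m) k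
  refine hπ.div_sq_le_meanPulls hδ0 hδ (by omega) hM hs hfin k m hg hσ fun t ht => ?_
  obtain ⟨j, hj⟩ := hbeat t ht
  exact Or.inl ⟨m, j, by simpa using hj⟩

/-- The global mean of arm `k` moves by `t / M` only, when the mean of arm `k` of one client moves
by `t`. -/
theorem IsPAC.div_globalGap_sq_le_meanPulls {δ : ℝ} (hδ0 : 0 < δ) (hδ : 2.4 * δ < 1)
    (hπ : π.IsPAC δ) (hK : 1 < K) (hM : 0 < M) {μ : Instance K M} {s : Answer K M}
    (hs : IsAnswer μ s) (hfin : ∀ k m, π.meanPulls μ k m ≠ ⊤) (k : Fin K) (m : Fin M) :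
    Real.log (1 / (2.4 * δ)) / ((M : ℝ) ^ 2 * globalGap μ s k ^ 2)
      ≤ (π.meanPulls μ k m).toReal := by
  have hM' : (0 : ℝ) < M := by positivity
  obtain ⟨hg, σ, hσ, hbeat⟩ := exists_shift_beats hK (v := globalMean μ) hs.2 k
  rw [← mul_pow]
  refine hπ.div_sq_le_meanPulls hδ0 hδ (by omega) hM hs hfin k m (mul_pos hM' hg) hσ
    fun t ht => ?_
  obtain ⟨j, hj⟩ := hbeat (t / M) (by rwa [lt_div_iff₀' hM'])
  have hmean : ∀ i, globalMean (fun i l => μ i l + if i = k ∧ l = m then σ * t else 0) i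
      = globalMean μ i + if i = k then σ * (t / M) else 0 := by
    intro i
    by_cases hi : i = k
    · simp only [globalMean, hi, true_and, if_true, Finset.sum_add_distrib, Finset.sum_ite_eq',
        Finset.mem_univ]
      ring
    · simp [globalMean, hi]
  refine Or.inr ⟨j, ?_⟩
  rwa [hmean, hmean]

end Algorithm

end FedBandit

end

theorem theorem3 (K M : ℕ) (hK : 1 < K) (hM : 1 < M) (δ : ℝ) (hδ0 : 0 < δ) (hδ1 : δ < 1)
    (μ : FedBandit.Instance K M) (s : FedBandit.Answer K M) (hs : FedBandit.IsAnswer μ s) :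
    ENNReal.ofReal
        (∑ k : Fin K, ∑ m : Fin M,
          max (Real.log (1 / (2.4 * δ)) / FedBandit.localGap μ s k m ^ 2)
            (Real.log (1 / (2.4 * δ)) / ((M : ℝ) ^ 2 * FedBandit.globalGap μ s k ^ 2)))
      ≤ ⨅ (π : FedBandit.Algorithm K M) (_ : π.IsPAC δ) (_ : π.CommunicatesEveryStep),
          π.expectedPulls μ := by
  refine le_iInf fun π => le_iInf fun hπ => le_iInf fun _ => ?_
  rcases lt_or_ge (2.4 * δ) 1 with hδ | hδ
  · by_cases htop : π.expectedPulls μ = ⊤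
    · rw [htop]; exact le_top
    refine ENNReal.ofReal_le_of_le_toReal ?_
    rw [π.expectedPulls_eq_sum] at htop ⊢
    have hfin' : ∀ k, ∑ m, π.meanPulls μ k m ≠ ⊤ := fun k =>
      (ENNReal.sum_ne_top.1 htop) k (Finset.mem_univ k)
    have hfin : ∀ k m, π.meanPulls μ k m ≠ ⊤ := fun k m =>
      (ENNReal.sum_ne_top.1 (hfin' k)) m (Finset.mem_univ m)
    rw [ENNReal.toReal_sum fun k _ => hfin' k]
    refine Finset.sum_le_sum fun k _ => ?_
    rw [ENNReal.toReal_sum fun m _ => hfin k m]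
    exact Finset.sum_le_sum fun m _ => max_le
      (hπ.div_localGap_sq_le_meanPulls hδ0 hδ hK (by omega) hs hfin k m)
      (hπ.div_globalGap_sq_le_meanPulls hδ0 hδ hK (by omega) hs hfin k m)
  · -- The logarithm is nonpositive, and so is the bound.
    have hlog : Real.log (1 / (2.4 * δ)) ≤ 0 :=
      Real.log_nonpos (by positivity) (by rw [div_le_one (by positivity)]; exact hδ)
    rw [ENNReal.ofReal_of_nonpos]
    · exact zero_le
    · exact Finset.sum_nonpos fun k _ => Finset.sum_nonpos fun m _ => max_le
        (div_nonpos_of_nonpos_of_nonneg hlog (by positivity))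
        (div_nonpos_of_nonpos_of_nonneg hlog (by positivity))
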